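/- Let $M$ be a complex manifold (Hausdorff, second countable) of dimension $m$, and let $D=\bigcup_{i} D_i\subset M$ be a nonempty compact connected simple normal crossing hypersurface with finitely many irreducible components $D_i$: each $D_i$ is nonempty and connected, and every point $p\in M$ is the centre of a holomorphic chart in which the components through $p$ are distinct coordinate hyperplanes and which meets no other component. Let $\widehat{\mathrm{Diff}}(\mathbb C,0)$ be the group, under composition, of formal power series $a_1z+a_2z^2+\cdots\in\mathbb C[[z]]$ with $a_1\neq 0$, and let $\widehat{\mathrm{Diff}}(\mathbb C,0)_1$ be its subgroup of elements tangent to the identity ($a_1=1$). Let $q\in M-D$ and let $\rho:\pi_1(M-D,q)\to\widehat{\mathrm{Diff}}(\mathbb C,0)_1$ be a group homomorphism. A small loop around $D_i$ is an element of $\pi_1(M-D,q)$ of the form $[\delta\cdot c\cdot\delta^{-1}]$, where, for some holomorphic chart $z=(z_1,\dots,z_m)$ whose domain meets no $D_j$ with $j\ne i$ and meets $D_i$ exactly in a coordinate hyperplane $\{z_s=0\}$, $c$ is a circle $z_s=re^{2\pi i t}$, $0\le t\le 1$, $z_l=0$ for $l\neq s$, with $r>0$ such that the closed disc of radius $r$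 on the $z_s$-axis is contained in the image of the chart, and $\delta$ is a path in $M-D$ from $q$ to the starting point of $c$. Assume that $\rho(\gamma)\neq\mathrm{id}$ for every $i$ and every small loop $\gamma$ around $D_i$. Then there exists an open neighborhood $U$ of $D$ in $M$, with $U-D$ path connected, such that the restriction of $\rho$ to $U-D$ has abelian image; that is, for every $q'\in U-D$ and every path $\delta$ in $M-D$ from $q'$ to $q$, the composition $$\pi_1(U-D,q')\longrightarrow\pi_1(M-D,q')\overset{\delta}{\simeq}\pi_1(M-D,q)\overset{\rho}{\longrightarrow}\widehat{\mathrm{Diff}}(\mathbb C,0)_1$$ has abelian image. -/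

import Mathlib

open scoped Manifold ContDiff

noncomputable section

/-! ### Formal biholomorphisms of `(ℂ, 0)` -/

/-- A formal biholomorphism of `(ℂ, 0)`: a formal power series
`a₁ z + a₂ z² + ⋯` with complex coefficients and `a₁ ≠ 0`. -/
@[ext]
structure FormalDiff where
  /-- the underlying formal power series -/
  series : PowerSeries ℂ
  constantCoeff_eq_zero : PowerSeries.constantCoeff series = 0
  coeff_one_ne_zero : PowerSeries.coeff 1 series ≠ 0

namespace FormalDiff

theorem hasSubst (g : FormalDiff) : PowerSeries.HasSubst g.series :=
  PowerSeries.HasSubst.of_constantCoeff_zero' g.constantCoeff_eq_zero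

theorem constantCoeff_comp (f g : FormalDiff) :
    PowerSeries.constantCoeff (PowerSeries.subst g.series f.series : PowerSeries ℂ) = 0 := by
  have h := PowerSeries.coeff_subst' g.hasSubst f.series 0
  rw [finsum_eq_single _ 0] at h
  · simpa [f.constantCoeff_eq_zero] using h
  · intro n hn
    simp [g.constantCoeff_eq_zero, hn]

theorem coeff_one_comp (f g : FormalDiff) :
    PowerSeries.coeff 1 (PowerSeries.subst g.series f.series : PowerSeries ℂ) =
      PowerSeries.coeff 1 f.series * PowerSeries.coeff 1 g.series := by
  rw [PowerSeries.coeff_subst' g.hasSubst, finsum_eq_single _ 1]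
  · simp
  · intro n hn
    obtain ⟨h, hh⟩ := PowerSeries.X_dvd_iff.mpr g.constantCoeff_eq_zero
    rcases n with _ | _ | n
    · simp [f.constantCoeff_eq_zero]
    · exact absurd rfl hn
    · simp [hh, mul_pow, PowerSeries.coeff_X_pow_mul']

/-- The product of `f` and `g` is the composition `f ∘ g`, i.e. the series `f(g(z))`. -/
instance : Mul FormalDiff where
  mul f g := ⟨PowerSeries.subst g.series f.series, constantCoeff_comp f g, by
    rw [coeff_one_comp]; exact mul_ne_zero f.coeff_one_ne_zero g.coeff_one_ne_zero⟩

/-- The neutral element is the identity, i.e. the series `z`. -/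
instance : One FormalDiff where
  one := ⟨PowerSeries.X, by simp, by simp⟩

/-- The inverse is the compositional inverse. -/
instance : Inv FormalDiff where
  inv f := ⟨f.series.substInvOfIsUnit f.coeff_one_ne_zero.isUnit, by simp, by
    rw [PowerSeries.coeff_one_substInvOfIsUnit]; exact Units.ne_zero _⟩

theorem mul_series (f g : FormalDiff) :
    (f * g).series = PowerSeries.subst g.series f.series := rfl

theorem one_series : (1 : FormalDiff).series = PowerSeries.X := rfl

theorem inv_series (f : FormalDiff) :
    f⁻¹.series = f.series.substInvOfIsUnit f.coeff_one_ne_zero.isUnit := rfl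

/-- The group of formal biholomorphisms of `(ℂ, 0)` under composition. -/
instance : Group FormalDiff :=
  Group.ofLeftAxioms
    (fun f g h => by
      ext1
      simp only [mul_series]
      exact (PowerSeries.subst_comp_subst_apply g.hasSubst h.hasSubst f.series))
    (fun f => by
      ext1
      rw [mul_series, one_series, PowerSeries.subst_X f.hasSubst])
    (fun f => by
      ext1
      rw [mul_series, inv_series, one_series]
      exact PowerSeries.subst_substInvOfIsUnit_left f.series f.constantCoeff_eq_zero
        f.coeff_one_ne_zero.isUnit)

/-- The derivative at the origin, as a group homomorphism. -/
def linearPart : FormalDiff →* ℂ where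
  toFun f := PowerSeries.coeff 1 f.series
  map_one' := by rw [one_series, PowerSeries.coeff_one_X]
  map_mul' f g := by rw [mul_series, coeff_one_comp]

/-- The subgroup of formal biholomorphisms tangent to the identity: those of the form
`z + a₂ z² + ⋯`. -/
def tangentToId : Subgroup FormalDiff := linearPart.ker

theorem mem_tangentToId (f : FormalDiff) :
    f ∈ tangentToId ↔ PowerSeries.coeff 1 f.series = 1 := Iff.rfl

end FormalDiff

/-! ### Simple normal crossing hypersurfaces and small loops around their components

Throughout, `M` is a complex manifold of dimension `m`, modelled on `Fin m → ℂ`. -/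

/-- The sets `D i` are the irreducible components of a simple normal crossing hypersurface of the
`m`-dimensional complex manifold `M`.  Every `D i` is nonempty and connected, and every point `p`
of `M` is the centre of a holomorphic chart in which the components through `p` are distinct
coordinate hyperplanes, and which meets no other component.  In particular each `D i` is a closed
smooth connected (hence irreducible) hypersurface. -/
structure IsSimpleNormalCrossing {m : ℕ} {M : Type*} [TopologicalSpace M]
    [ChartedSpace (Fin m → ℂ) M] {ι : Type*} (D : ι → Set M) : Prop where
  isConnected : ∀ i, IsConnected (D i)
  exists_chart : ∀ p : M,
    ∃ φ ∈ IsManifold.maximalAtlas 𝓘(ℂ, Fin m → ℂ) ω M, p ∈ φ.source ∧ φ p = 0 ∧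
      ∃ σ : {i : ι // p ∈ D i} → Fin m, Function.Injective σ ∧
        (∀ i : {i : ι // p ∈ D i},
          D i ∩ φ.source = {x | x ∈ φ.source ∧ φ x (σ i) = 0}) ∧
        ∀ j : ι, p ∉ D j → Disjoint (D j) φ.source

/-- The complement `M - D` of `D = ⋃ i, D i`, as a topological space. -/
abbrev DivisorCompl {M ι : Type*} (D : ι → Set M) : Type _ :=
  ((⋃ i, D i)ᶜ : Set M)

/-- `γ ∈ π₁(M - D, q)` is the class of a small loop around the component `D i`.  That is, for some
holomorphic chart meeting `D` only along `D i`, in which `D i` is the coordinate hyperplane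
`z_s = 0`, and some `r > 0` such that the closed disc of radius `r` on the `z_s`-axis is contained
in the image of the chart, `γ` is the class of `δ · c · δ⁻¹` where `c` is the boundary circle of
that disc, run through once counterclockwise, and `δ` is a path in `M - D` from `q` to the starting
point of `c`. -/
def IsSmallLoop {m : ℕ} {M : Type*} [TopologicalSpace M] [ChartedSpace (Fin m → ℂ) M]
    {ι : Type*} (D : ι → Set M) (i : ι) {q : DivisorCompl D}
    (γ : FundamentalGroup (DivisorCompl D) q) : Prop :=
  ∃ φ ∈ IsManifold.maximalAtlas 𝓘(ℂ, Fin m → ℂ) ω M, ∃ (s : Fin m) (r : ℝ),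
    D i ∩ φ.source = {x | x ∈ φ.source ∧ φ x s = 0} ∧
    (∀ j, j ≠ i → Disjoint (D j) φ.source) ∧
    0 < r ∧
    (∀ w : ℂ, ‖w‖ ≤ r → (Pi.single s w : Fin m → ℂ) ∈ φ.target) ∧
    ∃ (x : DivisorCompl D) (c : Path x x) (δ : Path q x),
      (∀ t : unitInterval, (c t : M) =
        φ.symm (Pi.single s ((r : ℂ) * Complex.exp (2 * Real.pi * (t : ℝ) * Complex.I)))) ∧
      γ = FundamentalGroup.fromPath ⟦(δ.trans c).trans δ.symm⟧

/-- The inclusion of `U - D` in `M - D`. -/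
def divisorComplInclusion {M : Type*} [TopologicalSpace M] {ι : Type*} (D : ι → Set M)
    (U : Set M) : C((U \ ⋃ i, D i : Set M), DivisorCompl D) where
  toFun x := ⟨x.1, x.2.2⟩

/-- The restriction to `U - D` of a representation `ρ` of `π₁(M - D, q)`: the composition
`π₁(U - D, q') → π₁(M - D, q') ≃ π₁(M - D, q) → G`, where the isomorphism in the middle is
the change of base point along a path `δ` in `M - D` from `q'` to `q`. -/
def restrictRepresentation {M : Type*} [TopologicalSpace M] {ι : Type*} (D : ι → Set M)
    {q : DivisorCompl D} {G : Type*} [Group G]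
    (ρ : FundamentalGroup (DivisorCompl D) q →* G) (U : Set M)
    (q' : (U \ ⋃ i, D i : Set M)) (δ : Path (divisorComplInclusion D U q') q) :
    FundamentalGroup (U \ ⋃ i, D i : Set M) q' →* G :=
  (ρ.comp (FundamentalGroup.fundamentalGroupMulEquivOfPath δ).toMonoidHom).comp
    (FundamentalGroup.map (divisorComplInclusion D U) q')

end

/-!
The theorem rests on two properties of the group of formal diffeomorphisms tangent to the identity:
among nontrivial elements commutation is transitive (`FormalDiff.commute_of_commute`), and a
nontrivial `f` that commutes with its conjugate by `g` commutes with `g` itself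
(`FormalDiff.commute_of_commute_conj`). Both follow from one computation. If
`f = z + a z ^ p + ⋯` and `g = z + b z ^ k + ⋯`, then
`f ∘ g - g ∘ f = (p - k) a b z ^ (p + k - 1) + ⋯`, so nontrivial commuting elements have the same
order of contact with the identity. On the other hand `f` is central modulo `z ^ (p + 1)`, so
the commutators that have to vanish have contact of order greater than `p` with the identity, while
they commute with `f`; hence they are trivial.

On the topological side, the divisor has small neighbourhoods `Q`, polydiscs in adapted charts, such
that `Q - D` is path connected and any two loops in `Q - D` commute in `π₁(M - D)`: a punctured
polydisc is a product of punctured discs and discs, homeomorphic to the topological groups `ℂˣ` and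
`ℂ`, and the product of two loops in such a group spans a square. By the Lebesgue number lemma one
can take these neighbourhoods so small that the union of two of them that meet lies in a larger one
with the same property; `U` is their union. Each `Q - D` contains a small loop around a component,
and the conjugates of these by paths in `Q - D` are called local loops. Two local loops at the same
point commute, and their images under `ρ` are not trivial. By transitivity of commutation the
images of the local loops at the two ends of a path in `U - D` commute after transport along the
path, as one sees by subdividing it (`transportCommutes`). For a loop in `U - D` this says that the
image `f ≠ 1` of a local loop commutes with its conjugate by the image of the loop, hence with this
image. So all of `π₁(U - D)` is mapped into the centralizer of `f`, which is commutative
(`commute_of_loops_mem_iUnion`).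
-/

/-! ### Commuting formal diffeomorphisms tangent to the identity -/

open PowerSeries in
/-- Substituting two series that agree modulo `X ^ n` gives results that agree modulo `X ^ n`. -/
theorem PowerSeries.X_pow_dvd_subst_sub_subst {a b : PowerSeries ℂ}
    (ha : PowerSeries.constantCoeff a = 0) (hb : PowerSeries.constantCoeff b = 0) {n : ℕ}
    (h : (X : PowerSeries ℂ) ^ n ∣ a - b) (g : PowerSeries ℂ) :
    (X : PowerSeries ℂ) ^ n ∣ g.subst a - g.subst b := by
  rw [X_pow_dvd_iff]
  intro k hk
  rw [map_sub, coeff_subst' (HasSubst.of_constantCoeff_zero' ha),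
    coeff_subst' (HasSubst.of_constantCoeff_zero' hb), sub_eq_zero]
  refine finsum_congr fun d => ?_
  have hd := X_pow_dvd_iff.mp (h.trans (sub_dvd_pow_sub_pow a b d)) k hk
  rw [map_sub, sub_eq_zero] at hd
  rw [hd]

/-- The beginning of the binomial expansion: `(1 + x) ^ n ≡ 1 + n x` modulo `x ^ 2`. -/
theorem sq_dvd_one_add_pow_sub {R : Type*} [CommRing R] (x : R) (n : ℕ) :
    x ^ 2 ∣ (1 + x) ^ n - 1 - n * x := by
  induction n with
  | zero => simp
  | succ n ih =>
    obtain ⟨c, hc⟩ := ih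
    refine ⟨c * (1 + x) + n, ?_⟩
    push_cast
    linear_combination (1 + x) * hc

open PowerSeries in
/-- First order Taylor expansion of `F = X ^ p * u` at `X + X ^ k * v`: the first
correction term is `p u(0) v(0) X ^ (p + k - 1)`. -/
theorem PowerSeries.X_pow_dvd_subst_X_add_sub (p k : ℕ) (hk : 2 ≤ k) (u v : PowerSeries ℂ) :
    (X : PowerSeries ℂ) ^ (p + k) ∣
      (X ^ p * u).subst (X + X ^ k * v) - X ^ p * u -
        C (p * constantCoeff u * constantCoeff v) * X ^ (p + k - 1) := by
  obtain ⟨l, rfl⟩ : ∃ l, k = l + 2 := ⟨k - 2, by omega⟩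
  have h0 : constantCoeff (X + X ^ (l + 2) * v : PowerSeries ℂ) = 0 := by simp
  have hs := HasSubst.of_constantCoeff_zero' h0
  rw [subst_mul hs, subst_pow hs, subst_X hs]
  obtain ⟨c, hc⟩ := X_pow_dvd_subst_sub_subst h0 constantCoeff_X (n := l + 2) ⟨v, by ring⟩ u
  rw [X_subst] at hc
  obtain ⟨d, hd⟩ := sq_dvd_one_add_pow_sub (X ^ (l + 1) * v : PowerSeries ℂ) p
  obtain ⟨e, he⟩ : (X : PowerSeries ℂ) ∣ v * u - C (constantCoeff u * constantCoeff v) := by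
    rw [X_dvd_iff]; simp [mul_comm]
  have hX : (X + X ^ (l + 2) * v : PowerSeries ℂ) ^ p = X ^ p * (1 + X ^ (l + 1) * v) ^ p := by
    rw [← mul_pow]; congr 1; ring
  have h1 : (1 + X ^ (l + 1) * v : PowerSeries ℂ) ^ p
      = 1 + (p : PowerSeries ℂ) * (X ^ (l + 1) * v) + (X ^ (l + 1) * v) ^ 2 * d := by
    linear_combination hd
  have h2 : u.subst (X + X ^ (l + 2) * v : PowerSeries ℂ) = u + X ^ (l + 2) * c := by
    linear_combination hc
  rw [hX, h2, show p + (l + 2) - 1 = p + l + 1 by omega, h1]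
  refine ⟨(1 + (p : PowerSeries ℂ) * (X ^ (l + 1) * v) + (X ^ (l + 1) * v) ^ 2 * d) * c
    + X ^ l * v ^ 2 * d * u + (p : PowerSeries ℂ) * e, ?_⟩
  have hC : (C (p * constantCoeff u * constantCoeff v) : PowerSeries ℂ)
      = (p : PowerSeries ℂ) * C (constantCoeff u * constantCoeff v) := by
    rw [mul_assoc, map_mul, map_natCast]
  rw [hC]
  linear_combination (p : PowerSeries ℂ) * X ^ (p + l + 1) * he

namespace FormalDiff

open PowerSeries

/-- `f` agrees with the identity up to order `n`, that is, `f = z + O(z ^ n)`. -/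
def IsIdentityMod (n : ℕ) (f : FormalDiff) : Prop :=
  (X : PowerSeries ℂ) ^ n ∣ f.series - X

theorem isIdentityMod_two {f : FormalDiff} (hf : f ∈ tangentToId) : IsIdentityMod 2 f := by
  rw [IsIdentityMod, X_pow_dvd_iff]
  intro k hk
  rw [mem_tangentToId] at hf
  interval_cases k
  · simp [f.constantCoeff_eq_zero]
  · simp [hf]

/-- Two formal diffeomorphisms that agree up to order `n` differ, in the group, by an element that
agrees with the identity up to order `n`. -/
theorem isIdentityMod_inv_mul {f g : FormalDiff} {n : ℕ}
    (h : (X : PowerSeries ℂ) ^ n ∣ f.series - g.series) : IsIdentityMod n (g⁻¹ * f) := by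
  have h1 := X_pow_dvd_subst_sub_subst f.constantCoeff_eq_zero g.constantCoeff_eq_zero h
    (g⁻¹).series
  rw [← mul_series, ← mul_series, inv_mul_cancel, one_series] at h1
  exact h1

/-- A nontrivial element of the group tangent to the identity has the form `z + a z ^ p + ⋯` with
`p ≥ 2` and `a ≠ 0`. -/
theorem exists_series_eq_of_ne_one {f : FormalDiff} (hf : f ∈ tangentToId) (h1 : f ≠ 1) :
    ∃ (p : ℕ) (u : PowerSeries ℂ), 2 ≤ p ∧ constantCoeff u ≠ 0 ∧
      f.series = X + X ^ p * u := by
  have hne : f.series - X ≠ 0 := fun h => h1 (by ext1; rw [one_series]; exact sub_eq_zero.mp h)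
  have hu0 : coeff (f.series - X).order.toNat (f.series - X) ≠ 0 := coeff_order hne
  obtain ⟨u, hu⟩ := X_pow_order_dvd (φ := f.series - X)
  generalize (f.series - X).order.toNat = p at hu hu0
  refine ⟨p, u, ?_, ?_, by rw [← hu]; ring⟩
  · by_contra! hlt
    exact hu0 (X_pow_dvd_iff.mp (isIdentityMod_two hf) _ hlt)
  · rw [hu, coeff_X_pow_mul', if_pos le_rfl, Nat.sub_self] at hu0
    simpa using hu0

/-- Nontrivial commuting elements of the group tangent to the identity have the same order of
contact with the identity: if `f = z + a z ^ p + ⋯` and `g = z + b z ^ k + ⋯`, the coefficient of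
`z ^ (p + k - 1)` in `f ∘ g - g ∘ f` is `(p - k) a b`. -/
theorem eq_of_commute {f g : FormalDiff} (h : Commute f g) {p k : ℕ} {u v : PowerSeries ℂ}
    (hp : 2 ≤ p) (hk : 2 ≤ k) (hu : constantCoeff u ≠ 0) (hv : constantCoeff v ≠ 0)
    (hf : f.series = X + X ^ p * u) (hg : g.series = X + X ^ k * v) : p = k := by
  have h1 := X_pow_dvd_subst_X_add_sub p k hk u v
  have h2 := X_pow_dvd_subst_X_add_sub k p hp v u
  have hfg := congrArg series h.eq
  rw [mul_series, mul_series, hf, hg, subst_add (hg ▸ g.hasSubst), subst_X (hg ▸ g.hasSubst),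
    subst_add (hf ▸ f.hasSubst), subst_X (hf ▸ f.hasSubst)] at hfg
  rw [add_comm k p] at h2
  have h3 := dvd_sub h1 h2
  have h4 : (X : PowerSeries ℂ) ^ (p + k) ∣
      C (((k : ℂ) - p) * (constantCoeff u * constantCoeff v)) * X ^ (p + k - 1) := by
    convert! h3 using 1
    have hC : (C (((k : ℂ) - p) * (constantCoeff u * constantCoeff v)) : PowerSeries ℂ)
        = C (k * constantCoeff v * constantCoeff u)
          - C (p * constantCoeff u * constantCoeff v) := by
      rw [← map_sub]; congr 1; ring
    rw [hC]
    linear_combination -hfg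
  have h5 := X_pow_dvd_iff.mp h4 (p + k - 1) (by omega)
  rw [coeff_C_mul, coeff_X_pow_self, mul_one] at h5
  have h6 : (k : ℂ) - p = 0 := by
    rcases mul_eq_zero.mp h5 with h | h
    · exact h
    · exact absurd h (mul_ne_zero hu hv)
  exact_mod_cast (sub_eq_zero.mp h6).symm

/-- An element that commutes with `f = z + a z ^ p + ⋯`, `a ≠ 0`, and agrees with the identity to
higher order than `f` is trivial. -/
theorem eq_one_of_commute {f g : FormalDiff} (h : Commute f g) (hg : g ∈ tangentToId)
    {p : ℕ} {u : PowerSeries ℂ} (hp : 2 ≤ p) (hu : constantCoeff u ≠ 0)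
    (hf : f.series = X + X ^ p * u) (hgp : IsIdentityMod (p + 1) g) : g = 1 := by
  by_contra hne
  obtain ⟨k, v, hk, hv, hgv⟩ := exists_series_eq_of_ne_one hg hne
  obtain rfl := eq_of_commute h hp hk hu hv hf hgv
  rw [IsIdentityMod, hgv, add_sub_cancel_left, X_pow_dvd_iff] at hgp
  have := hgp p (by omega)
  rw [coeff_X_pow_mul', if_pos le_rfl, Nat.sub_self] at this
  exact hv (by simpa using this)

/-- An element `f = z + O(z ^ p)` is central modulo `z ^ (p + 1)` in the group tangent to the
identity. -/
theorem X_pow_dvd_mul_series_sub {f g : FormalDiff} (hg : g ∈ tangentToId) {p : ℕ} (hp : 2 ≤ p)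
    (hf : IsIdentityMod p f) : (X : PowerSeries ℂ) ^ (p + 1) ∣ (g * f).series - (f * g).series := by
  obtain ⟨u, hu⟩ := hf
  obtain ⟨v, hv⟩ := isIdentityMod_two hg
  have hfs : f.series = X + X ^ p * u := by linear_combination hu
  have hgs : g.series = X + X ^ 2 * v := by linear_combination hv
  obtain ⟨c, hc⟩ := X_pow_dvd_subst_X_add_sub 2 p hp v u
  obtain ⟨d, hd⟩ := X_pow_dvd_subst_X_add_sub p 2 le_rfl u v
  rw [mul_series, mul_series, hfs, hgs, subst_add (hfs ▸ f.hasSubst), subst_X (hfs ▸ f.hasSubst),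
    subst_add (hgs ▸ g.hasSubst), subst_X (hgs ▸ g.hasSubst)]
  rw [show 2 + p - 1 = p + 1 by omega] at hc
  rw [show p + 2 - 1 = p + 1 by omega] at hd
  refine ⟨X * c + C ((2 : ℕ) * constantCoeff v * constantCoeff u) - X * d
    - C (p * constantCoeff u * constantCoeff v), ?_⟩
  linear_combination hc - hd

/-- In the group tangent to the identity, a commutator `⁅g⁻¹, f⁻¹⁆` with `f = z + O(z ^ p)` agrees
with the identity up to order `p + 1`. -/
theorem isIdentityMod_commutator {f g : FormalDiff} (hg : g ∈ tangentToId) {p : ℕ} (hp : 2 ≤ p)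
    (hf : IsIdentityMod p f) : IsIdentityMod (p + 1) ((f * g)⁻¹ * (g * f)) :=
  isIdentityMod_inv_mul (X_pow_dvd_mul_series_sub hg hp hf)

/-- Commutation is a transitive relation among nontrivial elements tangent to the identity. -/
theorem commute_of_commute {f g h : FormalDiff} (hf : f ∈ tangentToId) (hg : g ∈ tangentToId)
    (hh : h ∈ tangentToId) (hf1 : f ≠ 1) (hfg : Commute f g) (hfh : Commute f h) :
    Commute g h := by
  by_cases hg1 : g = 1
  · exact hg1 ▸ Commute.one_left h
  obtain ⟨p, u, hp, hu, hfu⟩ := exists_series_eq_of_ne_one hf hf1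
  obtain ⟨k, v, hk, hv, hgv⟩ := exists_series_eq_of_ne_one hg hg1
  obtain rfl := eq_of_commute hfg hp hk hu hv hfu hgv
  have hgp : IsIdentityMod p g := ⟨v, by rw [hgv]; ring⟩
  have h1 : (g * h)⁻¹ * (h * g) = 1 :=
    eq_one_of_commute (((hfg.mul_right hfh).inv_right).mul_right (hfh.mul_right hfg))
      (mul_mem (inv_mem (mul_mem hg hh)) (mul_mem hh hg)) hp hu hfu
      (isIdentityMod_commutator hh hp hgp)
  exact inv_mul_eq_one.mp h1

/-- A nontrivial element `f` tangent to the identity commutes with every `g` tangent to the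
identity such that `f` commutes with its conjugate by `g`. -/
theorem commute_of_commute_conj {f g : FormalDiff} (hf : f ∈ tangentToId) (hg : g ∈ tangentToId)
    (hf1 : f ≠ 1) (h : Commute f (g⁻¹ * f * g)) : Commute f g := by
  obtain ⟨p, u, hp, hu, hfu⟩ := exists_series_eq_of_ne_one hf hf1
  have hfp : IsIdentityMod p f := ⟨u, by rw [hfu]; ring⟩
  have h1 : f⁻¹ * (g⁻¹ * f * g) = 1 := by
    refine eq_one_of_commute ((Commute.refl f).inv_right.mul_right h)
      (mul_mem (inv_mem hf) (mul_mem (mul_mem (inv_mem hg) hf) hg)) hp hu hfu ?_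
    have h2 : (X : PowerSeries ℂ) ^ (p + 1) ∣ (f * g).series - (g * f).series := by
      rw [← neg_sub, dvd_neg]; exact X_pow_dvd_mul_series_sub hg hp hfp
    have h3 := isIdentityMod_inv_mul h2
    rwa [show (g * f)⁻¹ * (f * g) = f⁻¹ * (g⁻¹ * f * g) by group] at h3
  have h2 : f = g⁻¹ * f * g := inv_mul_eq_one.mp h1
  rw [commute_iff_eq]
  nth_rw 2 [h2]
  group

end FormalDiff

/-! ### Loops conjugate to local loops -/

section LocalLoops

open CategoryTheory unitInterval

variable {X : Type*} [TopologicalSpace X] {G : Type*} [Group G]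

/-- The arrow of the fundamental groupoid given by a path. -/
noncomputable def Path.arrow {x y : X} (p : Path x y) :
    FundamentalGroupoid.mk x ⟶ FundamentalGroupoid.mk y :=
  Path.Homotopic.Quotient.mk p

theorem Path.arrow_trans {x y z : X} (p : Path x y) (q : Path y z) :
    (p.trans q).arrow = p.arrow ≫ q.arrow := rfl

theorem Path.arrow_symm {x y : X} (p : Path x y) : p.symm.arrow = CategoryTheory.inv p.arrow := by
  rw [← Groupoid.inv_eq_inv]; rfl

theorem Path.arrow_eq {x y : X} {p q : Path x y} (h : p.Homotopic q) : p.arrow = q.arrow :=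
  Path.Homotopic.Quotient.eq.mpr h

/-- The class of a loop in the fundamental group. -/
noncomputable def Path.loopClass {x : X} (a : Path x x) : FundamentalGroup X x := a.arrow

/-- The class in `π₁(X, q)` of the loop `w⁻¹ · a · w`. -/
noncomputable def Path.conjClass {x q : X} (w : Path x q) (a : Path x x) : FundamentalGroup X q :=
  FundamentalGroup.fundamentalGroupMulEquivOfPath w a.loopClass

theorem Path.conjClass_eq {x q : X} (w : Path x q) (a : Path x x) :
    w.conjClass a = CategoryTheory.inv w.arrow ≫ a.arrow ≫ w.arrow := by
  rw [← Path.arrow_symm]; rfl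

/-- Moving a loop along a path `p` and the connecting path to the base point accordingly does not
change the class. -/
theorem Path.conjClass_trans {x y q : X} (p : Path x y) (w : Path y q) (a : Path y y) :
    (p.trans w).conjClass ((p.trans a).trans p.symm) = w.conjClass a := by
  simp [Path.conjClass_eq, Path.arrow_trans, Path.arrow_symm]

/-- Changing the connecting path by a loop conjugates the class. The product `f * g` in
`FundamentalGroup` is the composite in which `g` is run through first. -/
theorem Path.conjClass_loop_trans {x q : X} (b : Path x x) (w : Path x q) (a : Path x x) :
    (b.trans w).conjClass a = w.conjClass b * w.conjClass a * (w.conjClass b)⁻¹ := by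
  rw [eq_mul_inv_iff_mul_eq]
  simp [Path.conjClass_eq, Path.arrow_trans, End.mul_def]

/-- Any two loops contained in `P` and based at the same point commute in the fundamental group of
the ambient space. -/
def LoopsCommute (P : Set X) : Prop :=
  ∀ (x : X) (a b : Path x x), (∀ t, a t ∈ P) → (∀ t, b t ∈ P) →
    Commute a.loopClass b.loopClass

/-- `a` is the loop `β · c · β⁻¹`, for some path `β` in `W`. -/
def IsConjIn (W : Set X) {x₀ : X} (c : Path x₀ x₀) {x : X} (a : Path x x) : Prop :=
  ∃ β : Path x x₀, (∀ t, β t ∈ W) ∧ a = (β.trans c).trans β.symm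

theorem Path.trans_mem {W : Set X} {x y z : X} {p : Path x y} {q : Path y z}
    (hp : ∀ t, p t ∈ W) (hq : ∀ t, q t ∈ W) (t : I) : p.trans q t ∈ W := by
  rw [Path.trans_apply]
  split_ifs
  · exact hp _
  · exact hq _

theorem Path.symm_mem {W : Set X} {x y : X} {p : Path x y} (hp : ∀ t, p t ∈ W) (t : I) :
    p.symm t ∈ W := hp _

theorem IsConjIn.mem {W : Set X} {x₀ x : X} {c : Path x₀ x₀} {a : Path x x}
    (h : IsConjIn W c a) (hc : ∀ t, c t ∈ W) : ∀ t, a t ∈ W := by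
  obtain ⟨β, hβ, rfl⟩ := h
  exact Path.trans_mem (Path.trans_mem hβ hc) (Path.symm_mem hβ)

variable {κ : Type*} {W : κ → Set X} {x₀ : κ → X} {c : ∀ k, Path (x₀ k) (x₀ k)} {q : X}
  {ρ : FundamentalGroup X q →* G}

/-- Along a path `p` from `x` to `y`, the local loops at `y` transported back to `x` commute, after
applying `ρ`, with the local loops at `x`. -/
def TransportCommutes (W : κ → Set X) (c : ∀ k, Path (x₀ k) (x₀ k))
    (ρ : FundamentalGroup X q →* G) {x y : X} (p : Path x y) : Prop :=
  ∀ (w : Path y q) (k l : κ) (a : Path x x) (b : Path y y),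
    IsConjIn (W k) (c k) a → IsConjIn (W l) (c l) b →
      Commute (ρ ((p.trans w).conjClass a)) (ρ (w.conjClass b))

theorem exists_isConjIn (hW : ∀ k, IsPathConnected (W k)) (hc : ∀ k t, c k t ∈ W k)
    {k : κ} {x : X} (hx : x ∈ W k) : ∃ a : Path x x, IsConjIn (W k) (c k) a := by
  have h0 : x₀ k ∈ W k := by simpa using hc k 0
  obtain ⟨β, hβ⟩ := (hW k).joinedIn x hx (x₀ k) h0
  exact ⟨_, β, hβ, rfl⟩

theorem map_conjClass_ne_one (hρ : ∀ k (w : Path (x₀ k) q), ρ (w.conjClass (c k)) ≠ 1)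
    {k : κ} {x : X} {a : Path x x} (ha : IsConjIn (W k) (c k) a) (w : Path x q) :
    ρ (w.conjClass a) ≠ 1 := by
  obtain ⟨β, -, rfl⟩ := ha
  have h := Path.conjClass_trans β (β.symm.trans w) (c k)
  have h2 : (β.trans (β.symm.trans w)).conjClass ((β.trans (c k)).trans β.symm)
      = w.conjClass ((β.trans (c k)).trans β.symm) := by
    simp [Path.conjClass_eq, Path.arrow_trans, Path.arrow_symm]
  rw [← h2, h]
  exact hρ k _

theorem commute_conjClass {k l : κ} (hc : ∀ k t, c k t ∈ W k)
    (hP : ∀ k l, (W k ∩ W l).Nonempty → LoopsCommute (W k ∪ W l))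
    {x : X} {a b : Path x x} (ha : IsConjIn (W k) (c k) a) (hb : IsConjIn (W l) (c l) b)
    (w : Path x q) : Commute (ρ (w.conjClass a)) (ρ (w.conjClass b)) := by
  have ha' := ha.mem (hc k)
  have hb' := hb.mem (hc l)
  have hx : x ∈ W k ∩ W l := ⟨by simpa using ha' 0, by simpa using hb' 0⟩
  exact ((hP k l ⟨x, hx⟩ x a b (fun t => Or.inl (ha' t)) fun t => Or.inr (hb' t)).map
    (FundamentalGroup.fundamentalGroupMulEquivOfPath w)).map ρ

/-- Transport along a path inside one of the sets `W k`: a local loop of `W k` at the end of the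
path is transported to such a loop, and commutes with all local loops at either end. -/
theorem transportCommutes_of_mem
    (hCT : ∀ f g h : G, f ≠ 1 → Commute f g → Commute f h → Commute g h)
    (hW : ∀ k, IsPathConnected (W k)) (hc : ∀ k t, c k t ∈ W k)
    (hP : ∀ k l, (W k ∩ W l).Nonempty → LoopsCommute (W k ∪ W l))
    (hρ : ∀ k (w : Path (x₀ k) q), ρ (w.conjClass (c k)) ≠ 1)
    {k : κ} {x y : X} (p : Path x y) (hp : ∀ t, p t ∈ W k) : TransportCommutes W c ρ p := by
  intro w l l' a b ha hb
  obtain ⟨d, hd⟩ := exists_isConjIn hW hc (show y ∈ W k by simpa using hp 1)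
  have hdb := commute_conjClass (ρ := ρ) hc hP hd hb w
  have hd1 := map_conjClass_ne_one hρ hd w
  obtain ⟨β, hβ, rfl⟩ := hd
  -- the loop at `x` obtained by moving the local loop `d` at `y` along `p`
  have hd' : IsConjIn (W k) (c k) (((p.trans β).trans (c k)).trans (p.trans β).symm) :=
    ⟨_, Path.trans_mem hp hβ, rfl⟩
  have had := commute_conjClass (ρ := ρ) hc hP hd' ha (p.trans w)
  have heq : (p.trans w).conjClass (((p.trans β).trans (c k)).trans (p.trans β).symm)
      = w.conjClass ((β.trans (c k)).trans β.symm) := by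
    simp [Path.conjClass_eq, Path.arrow_trans, Path.arrow_symm]
  rw [heq] at had
  exact hCT _ _ _ hd1 had hdb

theorem TransportCommutes.trans
    (hCT : ∀ f g h : G, f ≠ 1 → Commute f g → Commute f h → Commute g h)
    (hW : ∀ k, IsPathConnected (W k)) (hc : ∀ k t, c k t ∈ W k)
    (hρ : ∀ k (w : Path (x₀ k) q), ρ (w.conjClass (c k)) ≠ 1)
    {x y z : X} {p : Path x y} {p' : Path y z} (hy : y ∈ ⋃ k, W k)
    (hp : TransportCommutes W c ρ p) (hp' : TransportCommutes W c ρ p') :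
    TransportCommutes W c ρ (p.trans p') := by
  intro w l l' a b ha hb
  obtain ⟨k, hk⟩ := Set.mem_iUnion.mp hy
  obtain ⟨d, hd⟩ := exists_isConjIn hW hc hk
  have h1 := hp (p'.trans w) l k a d ha hd
  have h2 := hp' w k l' d b hd hb
  have heq : (p.trans (p'.trans w)).conjClass a = ((p.trans p').trans w).conjClass a := by
    simp [Path.conjClass_eq, Path.arrow_trans]
  rw [heq] at h1
  exact hCT _ _ _ (map_conjClass_ne_one hρ hd _) h1.symm h2

theorem TransportCommutes.of_homotopic {x y : X} {p p' : Path x y} (h : p.Homotopic p')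
    (hp : TransportCommutes W c ρ p) : TransportCommutes W c ρ p' := by
  intro w l l' a b ha hb
  have heq : (p.trans w).conjClass a = (p'.trans w).conjClass a := by
    simp [Path.conjClass_eq, Path.arrow_trans, Path.arrow_eq h]
  rw [← heq]
  exact hp w l l' a b ha hb

theorem TransportCommutes.of_cast {x y x' y' : X} {p : Path x y} {hx : x' = x} {hy : y' = y}
    (hp : TransportCommutes W c ρ (p.cast hx hy)) : TransportCommutes W c ρ p := by
  subst hx hy
  exact hp

/-- Transport along any path in the union of the sets `W k`, by subdivision of the path. -/
theorem transportCommutes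
    (hCT : ∀ f g h : G, f ≠ 1 → Commute f g → Commute f h → Commute g h)
    (hWo : ∀ k, IsOpen (W k))
    (hW : ∀ k, IsPathConnected (W k)) (hc : ∀ k t, c k t ∈ W k)
    (hP : ∀ k l, (W k ∩ W l).Nonempty → LoopsCommute (W k ∪ W l))
    (hρ : ∀ k (w : Path (x₀ k) q), ρ (w.conjClass (c k)) ≠ 1)
    {x y : X} (p : Path x y) (hp : ∀ t, p t ∈ ⋃ k, W k) : TransportCommutes W c ρ p := by
  obtain ⟨t, ht0, htm, ⟨N, hN⟩, htW⟩ :=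
    exists_monotone_Icc_subset_open_cover_unitInterval (c := fun k => p ⁻¹' W k)
      (fun k => (hWo k).preimage p.continuous)
      (fun s _ => by simpa using hp s)
  have key : ∀ n, TransportCommutes W c ρ (p.subpath 0 (t n)) := by
    intro n
    induction n with
    | zero =>
      obtain ⟨k, hk⟩ := Set.mem_iUnion.mp (hp 0)
      rw [ht0]
      refine transportCommutes_of_mem hCT hW hc hP hρ (k := k) _ fun s => ?_
      rw [Path.subpath_self]
      exact hk
    | succ n ih =>
      obtain ⟨k, hk⟩ := htW n
      refine TransportCommutes.of_homotopic ⟨Path.Homotopy.subpathTransSubpath p 0 (t n) (t (n+1))⟩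
        (ih.trans hCT hW hc hρ (hp _)
          (transportCommutes_of_mem hCT hW hc hP hρ (k := k) _ fun s => ?_))
      have hs : p.subpath (t n) (t (n + 1)) s ∈ Set.range (p.subpath (t n) (t (n + 1))) := ⟨s, rfl⟩
      rw [Path.range_subpath_of_le p _ _ (htm n.le_succ)] at hs
      obtain ⟨r, hr, hr'⟩ := hs
      rw [← hr']
      exact hk hr
  have h1 := key N
  rw [hN N le_rfl] at h1
  rw [Path.subpath_zero_one] at h1
  exact h1.of_cast

/-- Let the open path connected sets `W k` be such that, whenever two of them meet, loops in their
union commute, and let each contain a loop `c k` no conjugate of which is killed by `ρ`.  If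
commutation in `G` is transitive on nontrivial elements and a nontrivial element commutes with `g`
as soon as it commutes with its conjugate by `g`, then `ρ` has commutative image on the
loops contained in the union of the sets `W k`: they all commute with the image of a local loop. -/
theorem commute_of_loops_mem_iUnion
    (hCT : ∀ f g h : G, f ≠ 1 → Commute f g → Commute f h → Commute g h)
    (hconj : ∀ f g : G, f ≠ 1 → Commute f (g⁻¹ * f * g) → Commute f g)
    (hWo : ∀ k, IsOpen (W k))
    (hW : ∀ k, IsPathConnected (W k)) (hc : ∀ k t, c k t ∈ W k)
    (hP : ∀ k l, (W k ∩ W l).Nonempty → LoopsCommute (W k ∪ W l))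
    (hρ : ∀ k (w : Path (x₀ k) q), ρ (w.conjClass (c k)) ≠ 1)
    {x : X} (w : Path x q) (a b : Path x x) (ha : ∀ t, a t ∈ ⋃ k, W k)
    (hb : ∀ t, b t ∈ ⋃ k, W k) : Commute (ρ (w.conjClass a)) (ρ (w.conjClass b)) := by
  obtain ⟨k, hk⟩ := Set.mem_iUnion.mp (show x ∈ ⋃ k, W k by simpa using ha 0)
  obtain ⟨d, hd⟩ := exists_isConjIn hW hc hk
  have hd1 := map_conjClass_ne_one hρ hd w
  have key : ∀ e : Path x x, (∀ t, e t ∈ ⋃ k, W k) →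
      Commute (ρ (w.conjClass d)) (ρ (w.conjClass e)) := by
    intro e he
    have h := transportCommutes hCT hWo hW hc hP hρ e he w k k d d hd hd
    rw [Path.conjClass_loop_trans, map_mul, map_mul, map_inv] at h
    have h2 := hconj _ (ρ (w.conjClass e))⁻¹ hd1 (by rw [inv_inv]; exact h.symm)
    rwa [Commute.inv_right_iff] at h2
  exact hCT _ _ _ hd1 (key a ha) (key b hb)

end LocalLoops

/-! ### Polydiscs minus coordinate hyperplanes -/

section Polydisc

open unitInterval Metric

/-- If the loops `a` and `b` are the horizontal and the vertical sides of a square, they commute in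
the fundamental group. -/
theorem Path.commute_loopClass_of_square {X : Type*} [TopologicalSpace X] {x : X} (a b : Path x x)
    (F : C(I × I, X)) (h0 : ∀ s, F (s, 0) = a s) (h1 : ∀ s, F (s, 1) = a s)
    (h2 : ∀ t, F (0, t) = b t) (h3 : ∀ t, F (1, t) = b t) :
    Commute a.loopClass b.loopClass := by
  let bottom : Path ((0 : I), (0 : I)) (1, 0) := ⟨⟨fun s => (s, 0), by fun_prop⟩, rfl, rfl⟩
  let right : Path ((1 : I), (0 : I)) (1, 1) := ⟨⟨fun s => (1, s), by fun_prop⟩, rfl, rfl⟩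
  let left : Path ((0 : I), (0 : I)) (0, 1) := ⟨⟨fun s => (0, s), by fun_prop⟩, rfl, rfl⟩
  let top : Path ((0 : I), (1 : I)) (1, 1) := ⟨⟨fun s => (s, 1), by fun_prop⟩, rfl, rfl⟩
  have : ContractibleSpace I :=
    (convex_Icc (0 : ℝ) 1).contractibleSpace (Set.nonempty_Icc.2 zero_le_one)
  have h := (SimplyConnectedSpace.paths_homotopic (bottom.trans right) (left.trans top)).map F
  have e0 : x = F (0, 0) := by rw [h0]; exact a.source.symm
  have e1 : x = F (1, 1) := by rw [h1]; exact a.target.symm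
  have h' := h.pathCast e0 e1
  have ea : (((bottom.trans right).map F.continuous).cast e0 e1) = a.trans b := by
    ext t
    simp only [Path.cast_coe, Path.map_coe, Function.comp_apply, Path.trans_apply]
    split_ifs
    · exact h0 _
    · exact h3 _
  have eb : (((left.trans top).map F.continuous).cast e0 e1) = b.trans a := by
    ext t
    simp only [Path.cast_coe, Path.map_coe, Function.comp_apply, Path.trans_apply]
    split_ifs
    · exact h2 _
    · exact h1 _
  have h4 : (a.trans b).arrow = (b.trans a).arrow := Path.arrow_eq (ea ▸ eb ▸ h')
  exact h4.symm

variable {m : ℕ}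

/-- The polydisc of radius `r` minus the coordinate hyperplanes `z_s = 0`, `s ∈ S`. -/
def puncturedPolydisc (S : Set (Fin m)) (r : ℝ) : Set (Fin m → ℂ) :=
  {z | z ∈ ball 0 r ∧ ∀ s ∈ S, z s ≠ 0}

theorem mem_ball_pi_iff {r : ℝ} (hr : 0 < r) {z : Fin m → ℂ} :
    z ∈ ball (0 : Fin m → ℂ) r ↔ ∀ l, z l ∈ ball (0 : ℂ) r := by
  rw [ball_pi _ hr]; simp

theorem univBall_mem_ball {r : ℝ} (hr : 0 < r) (w : ℂ) :
    OpenPartialHomeomorph.univBall (0 : ℂ) r w ∈ ball (0 : ℂ) r := by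
  rw [← OpenPartialHomeomorph.univBall_target (0 : ℂ) hr]
  exact (OpenPartialHomeomorph.univBall (0 : ℂ) r).map_source (by simp)

theorem univBall_symm_right {r : ℝ} (hr : 0 < r) {w : ℂ} (hw : w ∈ ball (0 : ℂ) r) :
    OpenPartialHomeomorph.univBall (0 : ℂ) r ((OpenPartialHomeomorph.univBall (0 : ℂ) r).symm w)
      = w :=
  (OpenPartialHomeomorph.univBall (0 : ℂ) r).right_inv
    (by rwa [OpenPartialHomeomorph.univBall_target (0 : ℂ) hr])

theorem univBall_ne_zero {r : ℝ} {w : ℂ} (hw : w ≠ 0) :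
    OpenPartialHomeomorph.univBall (0 : ℂ) r w ≠ 0 := by
  intro h
  apply hw
  apply (OpenPartialHomeomorph.univBall (0 : ℂ) r).injOn (by simp) (by simp)
  rw [h, OpenPartialHomeomorph.univBall_apply_zero]

theorem univBall_symm_ne_zero {r : ℝ} (hr : 0 < r) {w : ℂ} (hw : w ∈ ball (0 : ℂ) r)
    (hw0 : w ≠ 0) : (OpenPartialHomeomorph.univBall (0 : ℂ) r).symm w ≠ 0 := by
  intro h
  rw [← univBall_symm_right hr hw, h, OpenPartialHomeomorph.univBall_apply_zero] at hw0
  exact hw0 rfl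

theorem isPathConnected_puncturedPolydisc (S : Set (Fin m)) {r : ℝ} (hr : 0 < r) :
    IsPathConnected (puncturedPolydisc S r) := by
  classical
  let T : Fin m → Set ℂ := fun l => if l ∈ S then {0}ᶜ else Set.univ
  have hT : ∀ l, IsPathConnected (T l) := by
    intro l
    by_cases hl : l ∈ S
    · simp only [T, if_pos hl]
      exact isPathConnected_compl_singleton_of_one_lt_rank (by simp) 0
    · simp only [T, if_neg hl]
      exact isPathConnected_univ
  have hc : Continuous fun (z : Fin m → ℂ) l => OpenPartialHomeomorph.univBall (0 : ℂ) r (z l) :=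
    continuous_pi fun l => (OpenPartialHomeomorph.continuous_univBall _ _).comp (continuous_apply l)
  have himage : (fun (z : Fin m → ℂ) l => OpenPartialHomeomorph.univBall (0 : ℂ) r (z l)) ''
      Set.univ.pi T = puncturedPolydisc S r := by
    ext z
    constructor
    · rintro ⟨y, hy, rfl⟩
      refine ⟨(mem_ball_pi_iff hr).mpr fun l => univBall_mem_ball hr _, fun s hs => ?_⟩
      have := hy s (Set.mem_univ s)
      simp only [T, if_pos hs] at this
      exact univBall_ne_zero this
    · rintro ⟨hz, hz0⟩
      rw [mem_ball_pi_iff hr] at hz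
      refine ⟨fun l => (OpenPartialHomeomorph.univBall (0 : ℂ) r).symm (z l), fun l _ => ?_,
        funext fun l => univBall_symm_right hr (hz l)⟩
      by_cases hl : l ∈ S
      · simp only [T, if_pos hl]
        exact univBall_symm_ne_zero hr (hz l) (hz0 l hl)
      · simp [T, if_neg hl]
  rw [← himage]
  exact (IsPathConnected.pi hT).image hc

/-- Loops in a punctured polydisc span a square. Each coordinate ranges over a punctured disc or a
disc, which is homeomorphic to the topological group `ℂˣ` or `ℂ`, and the product of the two loops
in this group gives the square. -/
theorem exists_square_puncturedPolydisc (S : Set (Fin m)) {r : ℝ} (hr : 0 < r) {a b : I → Fin m → ℂ}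
    {z : Fin m → ℂ} (ha : Continuous a) (hb : Continuous b) (ha0 : a 0 = z) (ha1 : a 1 = z)
    (hb0 : b 0 = z) (hb1 : b 1 = z) (haP : ∀ t, a t ∈ puncturedPolydisc S r)
    (hbP : ∀ t, b t ∈ puncturedPolydisc S r) :
    ∃ F : I × I → Fin m → ℂ, Continuous F ∧ (∀ x, F x ∈ puncturedPolydisc S r) ∧
      (∀ s, F (s, 0) = a s) ∧ (∀ s, F (s, 1) = a s) ∧ (∀ t, F (0, t) = b t) ∧
      ∀ t, F (1, t) = b t := by
  classical
  have hzP : z ∈ puncturedPolydisc S r := ha0 ▸ haP 0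
  set e := OpenPartialHomeomorph.univBall (0 : ℂ) r with he
  have hmem : ∀ {y : Fin m → ℂ}, y ∈ puncturedPolydisc S r → ∀ l, y l ∈ ball (0 : ℂ) r :=
    fun hy => (mem_ball_pi_iff hr).mp hy.1
  have hcont : ∀ {f : I → Fin m → ℂ}, Continuous f → (∀ t, f t ∈ puncturedPolydisc S r) →
      ∀ l, Continuous fun t => e.symm (f t l) := fun hf hfP l =>
    (OpenPartialHomeomorph.continuousOn_univBall_symm (0 : ℂ) r).comp_continuous
      ((continuous_apply l).comp hf) fun t => hmem (hfP t) l
  have hz0 : ∀ l ∈ S, e.symm (z l) ≠ 0 := fun l hl =>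
    univBall_symm_ne_zero hr (hmem hzP l) (hzP.2 l hl)
  refine ⟨fun x l => e (if l ∈ S then e.symm (a x.1 l) * e.symm (b x.2 l) / e.symm (z l)
    else e.symm (a x.1 l) + e.symm (b x.2 l) - e.symm (z l)), ?_, ?_, ?_, ?_, ?_, ?_⟩
  · refine continuous_pi fun l => (OpenPartialHomeomorph.continuous_univBall _ _).comp ?_
    have h1 := (hcont ha haP l).comp (continuous_fst (X := I) (Y := I))
    have h2 := (hcont hb hbP l).comp (continuous_snd (X := I) (Y := I))
    by_cases hl : l ∈ S
    · simp only [if_pos hl]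
      exact (h1.mul h2).div_const _
    · simp only [if_neg hl]
      exact (h1.add h2).sub continuous_const
  · intro x
    refine ⟨(mem_ball_pi_iff hr).mpr fun l => univBall_mem_ball hr _, fun l hl => ?_⟩
    simp only [if_pos hl]
    exact univBall_ne_zero (div_ne_zero (mul_ne_zero
      (univBall_symm_ne_zero hr (hmem (haP _) l) ((haP _).2 l hl))
      (univBall_symm_ne_zero hr (hmem (hbP _) l) ((hbP _).2 l hl))) (hz0 l hl))
  all_goals
    intro t
    funext l
    first
    | rw [← univBall_symm_right hr (hmem (haP t) l), ← he]
      by_cases hl : l ∈ S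
      · simp [hl, hb0, hb1, hz0 l hl]
      · simp [hl, hb0, hb1]
    | rw [← univBall_symm_right hr (hmem (hbP t) l), ← he]
      by_cases hl : l ∈ S
      · simp [hl, ha0, ha1, hz0 l hl]
      · simp [hl, ha0, ha1]

end Polydisc

/-! ### Polydisc neighbourhoods and small loops -/

section Neighbourhoods

open unitInterval Metric Topology

variable {m : ℕ} {M : Type*} [TopologicalSpace M]
  {ι : Type*} {D : ι → Set M}

theorem OpenPartialHomeomorph.exists_ball_subset {E : Type*} [SeminormedAddCommGroup E]
    (φ : OpenPartialHomeomorph M E) {p : M} (hp : p ∈ φ.source) (hp0 : φ p = 0) {V : Set M}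
    (hV : V ∈ 𝓝 p) : ∃ r > 0, ball 0 r ⊆ φ.target ∩ φ.symm ⁻¹' V := by
  refine Metric.mem_nhds_iff.mp ?_
  rw [← hp0]
  refine Filter.inter_mem (φ.open_target.mem_nhds (φ.map_source hp)) ?_
  apply (φ.continuousAt_symm (φ.map_source hp)).preimage_mem_nhds
  rwa [φ.left_inv hp]

/-- If the divisor is given by the coordinate hyperplanes `z_s = 0`, `s ∈ S`, in a polydisc in a
chart, its complement in the polydisc is path connected and has commuting loops. -/
theorem isPathConnected_and_loopsCommute_of_chart (φ : OpenPartialHomeomorph M (Fin m → ℂ))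
    (S : Set (Fin m)) (hS : ∀ x ∈ φ.source, x ∈ ⋃ i, D i ↔ ∃ s ∈ S, φ x s = 0)
    {r : ℝ} (hr : 0 < r) (hrφ : ball 0 r ⊆ φ.target) :
    IsPathConnected (Subtype.val ⁻¹' (φ.source ∩ φ ⁻¹' ball 0 r) : Set (DivisorCompl D)) ∧
      LoopsCommute (Subtype.val ⁻¹' (φ.source ∩ φ ⁻¹' ball 0 r) : Set (DivisorCompl D)) := by
  have hP : ∀ x : DivisorCompl D, (x : M) ∈ φ.source ∩ φ ⁻¹' ball 0 r →
      φ x ∈ puncturedPolydisc S r := fun x hx =>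
    ⟨hx.2, fun s hs h0 => x.2 ((hS x hx.1).mpr ⟨s, hs, h0⟩)⟩
  have hD : ∀ z ∈ puncturedPolydisc S r, φ.symm z ∈ (⋃ i, D i)ᶜ := by
    intro z hz h
    obtain ⟨s, hs, h0⟩ := (hS _ (φ.map_target (hrφ hz.1))).mp h
    rw [φ.right_inv (hrφ hz.1)] at h0
    exact hz.2 s hs h0
  constructor
  · rw [Topology.IsInducing.subtypeVal.isPathConnected_iff]
    have himage : φ.symm '' puncturedPolydisc S r = Subtype.val ''
        (Subtype.val ⁻¹' (φ.source ∩ φ ⁻¹' ball 0 r) : Set (DivisorCompl D)) := by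
      ext x
      constructor
      · rintro ⟨z, hz, rfl⟩
        refine ⟨⟨φ.symm z, hD z hz⟩, ⟨φ.map_target (hrφ hz.1), ?_⟩, rfl⟩
        change φ (φ.symm z) ∈ ball 0 r
        rw [φ.right_inv (hrφ hz.1)]
        exact hz.1
      · rintro ⟨x, hx, rfl⟩
        exact ⟨φ x, hP x hx, φ.left_inv hx.1⟩
    rw [← himage]
    exact (isPathConnected_puncturedPolydisc S hr).image'
      (φ.continuousOn_symm.mono fun z hz => hrφ hz.1)
  · intro x a b ha hb
    have hcont : ∀ c : Path x x, (∀ t, (c t : M) ∈ φ.source ∩ φ ⁻¹' ball 0 r) →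
        Continuous fun t => φ (c t) := fun c hc =>
      φ.continuousOn.comp_continuous (continuous_subtype_val.comp c.continuous) fun t => (hc t).1
    obtain ⟨F, hF, hFP, h0, h1, h2, h3⟩ := exists_square_puncturedPolydisc S hr (z := φ x)
      (hcont a ha) (hcont b hb) (by simp) (by simp) (by simp) (by simp)
      (fun t => hP _ (ha t)) (fun t => hP _ (hb t))
    refine Path.commute_loopClass_of_square a b
      ⟨fun y => ⟨φ.symm (F y), hD _ (hFP y)⟩, Continuous.subtype_mk
        (φ.continuousOn_symm.comp_continuous hF fun y => hrφ (hFP y).1) _⟩ ?_ ?_ ?_ ?_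
    all_goals
      intro t
      apply Subtype.ext
      simp only [ContinuousMap.coe_mk, h0, h1, h2, h3]
      first
      | exact φ.left_inv (ha t).1
      | exact φ.left_inv (hb t).1

variable [ChartedSpace (Fin m → ℂ) M]

/-- Every point has arbitrarily small open neighbourhoods in which the complement of the divisor is
path connected and has commuting loops. -/
theorem IsSimpleNormalCrossing.exists_nhds (hD : IsSimpleNormalCrossing (m := m) D) (p : M)
    {V : Set M} (hV : V ∈ 𝓝 p) :
    ∃ Q : Set M, IsOpen Q ∧ p ∈ Q ∧ Q ⊆ V ∧
      IsPathConnected (Subtype.val ⁻¹' Q : Set (DivisorCompl D)) ∧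
      LoopsCommute (Subtype.val ⁻¹' Q : Set (DivisorCompl D)) := by
  obtain ⟨φ, -, hp, hp0, τ, -, hτ, hdisj⟩ := hD.exists_chart p
  have hS : ∀ x ∈ φ.source, x ∈ ⋃ i, D i ↔ ∃ s ∈ Set.range τ, φ x s = 0 := by
    intro x hx
    rw [Set.mem_iUnion]
    constructor
    · rintro ⟨i, hi⟩
      have hpi : p ∈ D i := by
        by_contra hpi
        exact Set.disjoint_left.mp (hdisj i hpi) hi hx
      have : x ∈ D i ∩ φ.source := ⟨hi, hx⟩
      rw [hτ ⟨i, hpi⟩] at this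
      exact ⟨_, ⟨_, rfl⟩, this.2⟩
    · rintro ⟨_, ⟨i, rfl⟩, h0⟩
      have : x ∈ D i ∩ φ.source := by rw [hτ i]; exact ⟨hx, h0⟩
      exact ⟨i, this.1⟩
  obtain ⟨r, hr, hrV⟩ := φ.exists_ball_subset hp hp0 hV
  refine ⟨φ.source ∩ φ ⁻¹' ball 0 r, φ.isOpen_inter_preimage isOpen_ball,
    ⟨hp, ?_⟩, ?_, isPathConnected_and_loopsCommute_of_chart φ _ hS hr fun z hz => (hrV hz).1⟩
  · rw [Set.mem_preimage, hp0]
    exact mem_ball_self hr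
  · rintro x ⟨hx, hxr⟩
    have := (hrV hxr).2
    rwa [Set.mem_preimage, φ.left_inv hx] at this

/-- Near every point of the divisor there is a point that lies on a single component. -/
theorem IsSimpleNormalCrossing.exists_mem_unique (hD : IsSimpleNormalCrossing (m := m) D) {p : M}
    {i : ι} (hp : p ∈ D i) {V : Set M} (hV : V ∈ 𝓝 p) :
    ∃ p' ∈ V, p' ∈ D i ∧ ∀ j, j ≠ i → p' ∉ D j := by
  obtain ⟨φ, -, hpφ, hp0, τ, hinj, hτ, hdisj⟩ := hD.exists_chart p
  obtain ⟨r, hr, hrV⟩ := φ.exists_ball_subset hpφ hp0 hV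
  -- the only vanishing coordinate of `z` is the one that defines `D i`
  let z : Fin m → ℂ := fun l => if l = τ ⟨i, hp⟩ then 0 else ((r / 2 : ℝ) : ℂ)
  have hz : z ∈ ball (0 : Fin m → ℂ) r := by
    rw [mem_ball_pi_iff hr]
    intro l
    by_cases hl : l = τ ⟨i, hp⟩
    · simp [z, hl, hr]
    · simp only [z, if_neg hl, mem_ball_zero_iff, Complex.norm_real, Real.norm_eq_abs,
        abs_of_pos (half_pos hr)]
      linarith
  have hzt := (hrV hz).1
  refine ⟨φ.symm z, (hrV hz).2, ?_, fun j hj hzj => ?_⟩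
  · have : φ.symm z ∈ D i ∩ φ.source := by
      rw [hτ ⟨i, hp⟩]
      exact ⟨φ.map_target hzt, by rw [φ.right_inv hzt]; simp [z]⟩
    exact this.1
  · have hpj : p ∈ D j := by
      by_contra hpj
      exact Set.disjoint_left.mp (hdisj j hpj) hzj (φ.map_target hzt)
    have : φ.symm z ∈ D j ∩ φ.source := ⟨hzj, φ.map_target hzt⟩
    rw [hτ ⟨j, hpj⟩] at this
    have h2 := this.2
    have hne : τ ⟨j, hpj⟩ ≠ τ ⟨i, hp⟩ := fun h => hj (congrArg Subtype.val (hinj h))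
    rw [φ.right_inv hzt] at h2
    simp [z, hne, hr.ne'] at h2

/-- Every neighbourhood of a point of the divisor contains a circle around a component; it gives
small loops, whatever the path that connects it to the base point. -/
theorem IsSimpleNormalCrossing.exists_smallLoop (hD : IsSimpleNormalCrossing (m := m) D) {p : M}
    {i : ι} (hp : p ∈ D i) {V : Set M} (hV : IsOpen V) (hpV : p ∈ V) (q : DivisorCompl D) :
    ∃ (x : DivisorCompl D) (c : Path x x), (∀ t, (c t : M) ∈ V) ∧
      ∀ w : Path x q, IsSmallLoop (m := m) D i (w.conjClass c) := by
  obtain ⟨p', hp'V, hp'i, hp'j⟩ := hD.exists_mem_unique hp (hV.mem_nhds hpV)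
  obtain ⟨φ, hφ, hpφ, hp0, τ, -, hτ, hdisj⟩ := hD.exists_chart p'
  set s := τ ⟨i, hp'i⟩ with hs
  have hDs : D i ∩ φ.source = {x | x ∈ φ.source ∧ φ x s = 0} := hτ ⟨i, hp'i⟩
  obtain ⟨R, hR, hRV⟩ := φ.exists_ball_subset hpφ hp0 (hV.mem_nhds hp'V)
  have hdisc : ∀ w : ℂ, ‖w‖ ≤ R / 2 → (Pi.single s w : Fin m → ℂ) ∈ ball (0 : Fin m → ℂ) R := by
    intro w hw
    rw [mem_ball_zero_iff, Pi.norm_single]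
    linarith
  -- the circle lies in the open disc of radius `R` and avoids the hyperplane `z_s = 0`
  let e : I → ℂ := fun t => ((R / 2 : ℝ) : ℂ) * Complex.exp (2 * Real.pi * (t : ℝ) * Complex.I)
  have hecont : Continuous e := by fun_prop
  have hnorm : ∀ t, ‖e t‖ = R / 2 := by
    intro t
    have : (2 * Real.pi * (t : ℝ) * Complex.I : ℂ) = ((2 * Real.pi * t : ℝ) : ℂ) * Complex.I := by
      push_cast; ring
    simp only [e, norm_mul, this, Complex.norm_exp_ofReal_mul_I, Complex.norm_real,
      Real.norm_eq_abs, abs_of_pos (half_pos hR), mul_one]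
  have hball : ∀ t, (Pi.single s (e t) : Fin m → ℂ) ∈ ball (0 : Fin m → ℂ) R := fun t =>
    hdisc _ (hnorm t).le
  have hcompl : ∀ t, φ.symm (Pi.single s (e t)) ∈ (⋃ i, D i)ᶜ := by
    intro t h
    have hsrc := φ.map_target (hRV (hball t)).1
    obtain ⟨j, hj⟩ := Set.mem_iUnion.mp h
    by_cases hji : j = i
    · subst hji
      have h2 : φ.symm (Pi.single s (e t)) ∈ D j ∩ φ.source := ⟨hj, hsrc⟩
      rw [hDs] at h2
      have h3 := h2.2
      rw [φ.right_inv (hRV (hball t)).1, Pi.single_eq_same] at h3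
      have h4 := hnorm t
      rw [h3, norm_zero] at h4
      linarith
    · exact Set.disjoint_left.mp (hdisj j (hp'j j hji)) hj hsrc
  have hcont : Continuous fun t => φ.symm (Pi.single s (e t) : Fin m → ℂ) :=
    φ.continuousOn_symm.comp_continuous ((continuous_single s).comp hecont)
      fun t => (hRV (hball t)).1
  have he1 : e 1 = e 0 := by
    simp [e, Complex.exp_two_pi_mul_I]
  let c : Path (⟨_, hcompl 0⟩ : DivisorCompl D) ⟨_, hcompl 0⟩ :=
    { toFun := fun t => ⟨_, hcompl t⟩
      continuous_toFun := hcont.subtype_mk _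
      source' := rfl
      target' := by simp only [he1] }
  refine ⟨_, c, fun t => (hRV (hball t)).2, fun w => ⟨φ, hφ, s, R / 2, hDs,
    fun j hj => hdisj j (hp'j j hj), half_pos hR, fun w hw => (hRV (hdisc w hw)).1,
    _, c, w.symm, fun t => rfl, ?_⟩⟩
  change _ = ((w.symm.trans c).trans w.symm.symm).arrow
  simp [Path.conjClass_eq, Path.arrow_trans, Path.arrow_symm]

end Neighbourhoods

/-! ### The neighbourhood of the divisor -/

section Divisor

open unitInterval Metric Topology

/-- A union of open sets `Q k`, `k ∈ K`, minus a set `A`, is path connected if `K` is connected,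
`k ∈ Q k`, each `Q k \ A` is path connected and the complement of `A` accumulates at `K`. -/
theorem isPathConnected_iUnion_diff {M : Type*} [TopologicalSpace M] {K A : Set M}
    (hK : IsConnected K) {Q : K → Set M} (hQo : ∀ k, IsOpen (Q k)) (hkQ : ∀ k : K, (k : M) ∈ Q k)
    (hQ : ∀ k, IsPathConnected (Q k \ A)) (hA : ∀ k ∈ K, ∀ V ∈ 𝓝 k, (V \ A).Nonempty) :
    IsPathConnected ((⋃ k, Q k) \ A) := by
  have : ConnectedSpace K := isConnected_iff_connectedSpace.mp hK
  have hsub : ∀ k, Q k \ A ⊆ (⋃ k, Q k) \ A := fun k =>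
    Set.sdiff_subset_sdiff_left (Set.subset_iUnion Q k)
  have hsymm : Std.Symm fun k l : K =>
      ∀ x ∈ Q k \ A, ∀ y ∈ Q l \ A, JoinedIn ((⋃ k, Q k) \ A) x y :=
    ⟨fun k l h x hx y hy => (h y hy x hx).symm⟩
  have key : ∀ k l : K, ∀ x ∈ Q k \ A, ∀ y ∈ Q l \ A, JoinedIn ((⋃ k, Q k) \ A) x y := by
    refine PreconnectedSpace.induction₂ (fun k l : K =>
      ∀ x ∈ Q k \ A, ∀ y ∈ Q l \ A, JoinedIn ((⋃ k, Q k) \ A) x y) (fun k => ?_)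
      ⟨fun k l j h1 h2 x hx y hy => ?_⟩
    · filter_upwards [((hQo k).preimage continuous_subtype_val).mem_nhds (hkQ k)]
        with l hl x hx y hy
      obtain ⟨z, ⟨hzk, hzl⟩, hzA⟩ := hA l l.2 _
        (((hQo k).inter (hQo l)).mem_nhds ⟨hl, hkQ l⟩)
      exact (((hQ k).joinedIn x hx z ⟨hzk, hzA⟩).mono (hsub k)).trans
        (((hQ l).joinedIn z ⟨hzl, hzA⟩ y hy).mono (hsub l))
    · obtain ⟨z, hz⟩ := (hQ l).nonempty
      exact (h1 x hx z hz).trans (h2 z hz y hy)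
  rw [isPathConnected_iff]
  constructor
  · obtain ⟨k⟩ := (inferInstance : Nonempty K)
    exact (hQ k).nonempty.mono (hsub k)
  · rintro x ⟨hx, hxA⟩ y ⟨hy, hyA⟩
    obtain ⟨k, hk⟩ := Set.mem_iUnion.mp hx
    obtain ⟨l, hl⟩ := Set.mem_iUnion.mp hy
    exact key k l x ⟨hk, hxA⟩ y ⟨hl, hyA⟩

/-- Every open cover of a compact subset `K` of a metrizable space has a refinement, indexed by `K`,
such that the union of any two members that meet lies in a member of the cover. -/
theorem IsCompact.exists_nhds_union_subset {M : Type*} [TopologicalSpace M]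
    [TopologicalSpace.MetrizableSpace M] {K : Set M} (hK : IsCompact K) {P : K → Set M}
    (hPo : ∀ k, IsOpen (P k)) (hkP : ∀ k : K, (k : M) ∈ P k) :
    ∃ V : K → Set M, (∀ k : K, V k ∈ 𝓝 (k : M)) ∧
      ∀ k l : K, (V k ∩ V l).Nonempty → ∃ j, V k ∪ V l ⊆ P j := by
  let _ := TopologicalSpace.metrizableSpaceMetric M
  obtain ⟨δ, hδ, h⟩ := lebesgue_number_lemma_of_metric hK hPo
    (fun x hx => Set.mem_iUnion.mpr ⟨⟨x, hx⟩, hkP ⟨x, hx⟩⟩)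
  refine ⟨fun k => ball k (δ / 4), fun k => ball_mem_nhds _ (by positivity), ?_⟩
  rintro k l ⟨z, hzk, hzl⟩
  obtain ⟨j, hj⟩ := h k k.2
  refine ⟨j, Set.union_subset (fun y hy => hj ?_) fun y hy => hj ?_⟩
  · rw [mem_ball] at *
    linarith
  · rw [mem_ball] at *
    have h1 := dist_triangle4 y (l : M) z k
    rw [dist_comm (l : M) z] at h1
    linarith

variable {m : ℕ} {M : Type*} [TopologicalSpace M] [T2Space M] [SecondCountableTopology M]
  [ChartedSpace (Fin m → ℂ) M] {ι : Type*} {D : ι → Set M}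

/-- The conclusion for a representation in any group in which commutation is transitive on
nontrivial elements and a nontrivial element commutes with `g` as soon as it commutes with its
conjugate by `g`. -/
theorem IsSimpleNormalCrossing.exists_isMulCommutative_range {G : Type*} [Group G]
    (hCT : ∀ f g h : G, f ≠ 1 → Commute f g → Commute f h → Commute g h)
    (hconj : ∀ f g : G, f ≠ 1 → Commute f (g⁻¹ * f * g) → Commute f g)
    (hD : IsSimpleNormalCrossing (m := m) D)
    (hcompact : IsCompact (⋃ i, D i)) (hconn : IsConnected (⋃ i, D i)) (q : DivisorCompl D)
    (ρ : FundamentalGroup (DivisorCompl D) q →* G)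
    (hρ : ∀ (i : ι) (γ : FundamentalGroup (DivisorCompl D) q),
      IsSmallLoop (m := m) D i γ → ρ γ ≠ 1) :
    ∃ U : Set M, IsOpen U ∧ (⋃ i, D i) ⊆ U ∧ IsPathConnected (U \ ⋃ i, D i) ∧
      ∀ (q' : (U \ ⋃ i, D i : Set M)) (δ : Path (divisorComplInclusion D U q') q),
        IsMulCommutative (restrictRepresentation D ρ U q' δ).range := by
  have : LocallyCompactSpace M := ChartedSpace.locallyCompactSpace (Fin m → ℂ) M
  have : TopologicalSpace.MetrizableSpace M :=
    TopologicalSpace.metrizableSpace_of_t3_secondCountable M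
  -- coarse polydiscs, in which loops commute, then finer ones, two of which lie in a coarse one
  -- as soon as they meet
  choose P hPo hkP _ _ hPc using fun k : (⋃ i, D i : Set M) =>
    hD.exists_nhds (k : M) Filter.univ_mem
  obtain ⟨V, hV, hVP⟩ := hcompact.exists_nhds_union_subset hPo hkP
  choose Q hQo hkQ hQV hQp _ using fun k : (⋃ i, D i : Set M) => hD.exists_nhds (k : M) (hV k)
  choose i hi using fun k : (⋃ i, D i : Set M) => Set.mem_iUnion.mp k.2
  choose x₀ c hcQ hc using fun k => hD.exists_smallLoop (hi k) (hQo k) (hkQ k) q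
  have himage : ∀ Q : Set M, Subtype.val '' (Subtype.val ⁻¹' Q : Set (DivisorCompl D))
      = Q \ ⋃ i, D i := by
    intro Q
    rw [Subtype.image_preimage_coe, Set.inter_comm, Set.sdiff_eq]
  refine ⟨⋃ k, Q k, isOpen_iUnion hQo, fun x hx => Set.mem_iUnion.mpr ⟨⟨x, hx⟩, hkQ ⟨x, hx⟩⟩,
    isPathConnected_iUnion_diff hconn hQo hkQ (fun k => ?_) (fun k _ W hW => ?_), ?_⟩
  · rw [← himage, ← Topology.IsInducing.subtypeVal.isPathConnected_iff]
    exact hQp k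
  · obtain ⟨Q', -, -, hQ'W, hQ'p, -⟩ := hD.exists_nhds k hW
    obtain ⟨y, hy⟩ := hQ'p.nonempty
    exact ⟨y, hQ'W hy, y.2⟩
  · intro q' δ
    have key : ∀ a b : Path q' q', Commute
        (restrictRepresentation D ρ (⋃ k, Q k) q' δ a.loopClass)
        (restrictRepresentation D ρ (⋃ k, Q k) q' δ b.loopClass) := by
      have hmem : ∀ (a : Path q' q') (t : I),
          a.map (divisorComplInclusion D (⋃ k, Q k)).continuous t ∈
            ⋃ k, (Subtype.val ⁻¹' Q k : Set (DivisorCompl D)) := by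
        intro a t
        rw [← Set.preimage_iUnion]
        exact (a t).2.1
      intro a b
      exact commute_of_loops_mem_iUnion (W := fun k => (Subtype.val ⁻¹' Q k : Set (DivisorCompl D)))
        (c := c) (ρ := ρ) hCT hconj (fun k => (hQo k).preimage continuous_subtype_val) hQp hcQ
        (fun k l hkl y a b ha hb => by
          obtain ⟨z, hzk, hzl⟩ := hkl
          obtain ⟨j, hj⟩ := hVP k l ⟨z, hQV k hzk, hQV l hzl⟩
          have hsub : Q k ∪ Q l ⊆ P j := (Set.union_subset_union (hQV k) (hQV l)).trans hj
          exact hPc j y a b (fun t => hsub (ha t)) fun t => hsub (hb t))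
        (fun k w => hρ (i k) _ (hc k w)) δ _ _ (hmem a) (hmem b)
    refine ⟨⟨?_⟩⟩
    rintro ⟨_, α, rfl⟩ ⟨_, β, rfl⟩
    obtain ⟨a, rfl⟩ := Path.Homotopic.Quotient.mk_surjective α
    obtain ⟨b, rfl⟩ := Path.Homotopic.Quotient.mk_surjective β
    exact Subtype.ext (key a b).eq

end Divisor

theorem mainTheorem5 {m : ℕ} {M : Type*} [TopologicalSpace M] [T2Space M]
    [SecondCountableTopology M] [ChartedSpace (Fin m → ℂ) M]
    [IsManifold 𝓘(ℂ, Fin m → ℂ) ω M]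
    {ι : Type*} [Finite ι] (D : ι → Set M)
    (hD : IsSimpleNormalCrossing (m := m) D)
    (hcompact : IsCompact (⋃ i, D i)) (hconn : IsConnected (⋃ i, D i))
    (q : DivisorCompl D)
    (ρ : FundamentalGroup (DivisorCompl D) q →* FormalDiff.tangentToId)
    (hρ : ∀ (i : ι) (γ : FundamentalGroup (DivisorCompl D) q),
      IsSmallLoop (m := m) D i γ → ρ γ ≠ 1) :
    ∃ U : Set M, IsOpen U ∧ (⋃ i, D i) ⊆ U ∧ IsPathConnected (U \ ⋃ i, D i) ∧
      ∀ (q' : (U \ ⋃ i, D i : Set M)) (δ : Path (divisorComplInclusion D U q') q),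
        IsMulCommutative (restrictRepresentation D ρ U q' δ).range := by
  refine hD.exists_isMulCommutative_range (fun f g h hf hfg hfh => ?_) (fun f g hf h => ?_)
    hcompact hconn q ρ hρ
  · exact Subtype.ext (FormalDiff.commute_of_commute f.2 g.2 h.2 (fun h1 => hf (Subtype.ext h1))
      (congrArg Subtype.val hfg.eq) (congrArg Subtype.val hfh.eq)).eq
  · exact Subtype.ext (FormalDiff.commute_of_commute_conj f.2 g.2 (fun h1 => hf (Subtype.ext h1))
      (congrArg Subtype.val h.eq)).eq
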